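/- Let $p\ge 1$, let $k_1,\dots,k_p\ge 3$ be integers, and put $n=k_1+\cdots+k_p$. Divide the matrices of $\mathfrak{so}(n)$ into $p\times p$ blocks, the $(i,j)$ block being of size $k_i\times k_j$. For $1\le i\le p$ let $\mathfrak{m}_i=\mathfrak{so}(k_i)\subset\mathfrak{so}(n)$ be the subspace of skew-symmetric matrices that vanish outside the $(i,i)$ block, and for $1\le i<j\le p$ let $\mathfrak{m}_{ij}\subset\mathfrak{so}(n)$ be the subspace of those that vanish outside the $(i,j)$ and $(j,i)$ blocks, so that $$\mathfrak{so}(n)=\bigoplus_{i=1}^p\mathfrak{m}_i\ \oplus\bigoplus_{1\le i<j\le p}\mathfrak{m}_{ij}.$$ Let $B$ be the Killing form of $\mathfrak{so}(n)$. For positive real numbers $x_i$ ($1\le i\le p$) and $x_{ij}=x_{ji}$ ($i\ne j$), consider the left-invariant Riemannian metric on $\mathrm{SO}(n)$ determined by the scalar product $$\langle\ ,\ \rangle=\sum_{i=1}^p x_i\,(-B)|_{\mathfrak{m}_i}+\sum_{1\le i<j\le p}x_{ij}\,(-B)|_{\mathfrak{m}_{ij}}$$ on $\mathfrak{so}(n)$,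 and let $r$ be its Ricci tensor (also left-invariant). Then $r(A,C)=r_i\langle A,C\rangle$ for all $A\in\mathfrak{m}_i$, $C\in\mathfrak{so}(n)$, and $r(A,C)=r_{ij}\langle A,C\rangle$ for all $A\in\mathfrak{m}_{ij}$, $C\in\mathfrak{so}(n)$, where the components $r_i$, $r_{ij}$ of the Ricci tensor are $$r_i=\frac{k_i-2}{4(n-2)\,x_i}+\frac{1}{4(n-2)}\sum_{\substack{j=1\\ j\ne i}}^p k_j\,\frac{x_i}{x_{ij}^2},\qquad 1\le i\le p,$$ $$r_{ij}=\frac{1}{2x_{ij}}+\sum_{\substack{l=1\\ l\ne i,j}}^p\frac{k_l}{4(n-2)}\left(\frac{x_{ij}}{x_{il}x_{jl}}-\frac{x_{il}}{x_{ij}x_{jl}}-\frac{x_{jl}}{x_{ij}x_{il}}\right)-\frac{k_i-1}{4(n-2)}\,\frac{x_i}{x_{ij}^2}-\frac{k_j-1}{4(n-2)}\,\frac{x_j}{x_{ij}^2},\qquad 1\le i<j\le p.$$ -/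

import Mathlib

open scoped Matrix

noncomputable section

namespace SOGeometry

open Matrix LieAlgebra.Orthogonal

/-- The group `SO(n)`, with rows and columns indexed by a finite type `m` of cardinality `n`. -/
abbrev SO (m : Type) [Fintype m] [DecidableEq m] : Type := specialOrthogonalGroup m ℝ

section Exponential

variable {m : Type} [Fintype m] [DecidableEq m]

theorem exp_mem_orthogonal (A : so m ℝ) :
    NormedSpace.exp (A : Matrix m m ℝ) ∈ orthogonalGroup m ℝ := by
  have hA : (A : Matrix m m ℝ)ᵀ = -A := (mem_so m ℝ _).1 A.2
  rw [mem_orthogonalGroup_iff', ← Matrix.exp_transpose, hA,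
    ← Matrix.exp_add_of_commute _ _ (Commute.refl (A : Matrix m m ℝ)).neg_left]
  simp

theorem exp_mem (A : so m ℝ) :
    NormedSpace.exp (A : Matrix m m ℝ) ∈ specialOrthogonalGroup m ℝ := by
  refine mem_specialOrthogonalGroup_iff.2 ⟨exp_mem_orthogonal A, ?_⟩
  have h1 : (NormedSpace.exp (A : Matrix m m ℝ)).det ^ 2 = 1 := by
    have h := (mem_orthogonalGroup_iff' m ℝ).1 (exp_mem_orthogonal A)
    have h' := congrArg Matrix.det h
    rw [Matrix.det_mul, Matrix.det_transpose, Matrix.det_one] at h'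
    rw [sq, h']
  have h2 : 0 ≤ (NormedSpace.exp (A : Matrix m m ℝ)).det := by
    have h : (A : Matrix m m ℝ) = (2⁻¹ : ℝ) • (A : Matrix m m ℝ) + (2⁻¹ : ℝ) • A := by
      rw [← add_smul]; norm_num
    rw [h, Matrix.exp_add_of_commute _ _ (Commute.refl _), Matrix.det_mul]
    exact mul_self_nonneg _
  nlinarith

/-- The exponential map of `SO(n)`. -/
def expSO (A : so m ℝ) : SO m := ⟨NormedSpace.exp (A : Matrix m m ℝ), exp_mem A⟩

/-- A function on the compact submanifold `SO(n)` of the space of matrices is smooth when it is the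
restriction of a smooth function of the matrix entries, defined for all matrices. -/
def SmoothFun (f : SO m → ℝ) : Prop :=
  ∃ F : (m → m → ℝ) → ℝ, ContDiff ℝ (⊤ : ℕ∞) F ∧
    ∀ g : SO m, F (fun a b => (g : Matrix m m ℝ) a b) = f g

/-- A vector field on `SO(n)` is written in the left trivialization of the tangent bundle,
`T_g SO(n) = {g A | A ∈ so(n)}`: the function `X : SO(n) → so(n)` stands for the vector field whose
value at `g` is the tangent vector `g * X g`. The left-invariant fields are the constant functions.
The field is smooth when the entries of `X` are. -/
def SmoothField (X : SO m → so m ℝ) : Prop :=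
  ∀ a b, SmoothFun fun g => (X g : Matrix m m ℝ) a b

/-- The derivative of a function `f` on `SO(n)` along the vector field `X`: at `g` it is the
derivative at `t = 0` of `f` along the curve `t ↦ g exp (t X(g))`, which has velocity `g * X g`. -/
def along (X : SO m → so m ℝ) (f : SO m → ℝ) (g : SO m) : ℝ :=
  deriv (fun t : ℝ => f (g * expSO (t • X g))) 0

/-- The entrywise derivative of a function `Y : SO(n) → so(n)` along the vector field `X`. -/
def alongField (X Y : SO m → so m ℝ) (g : SO m) : so m ℝ :=
  ⟨Matrix.of fun a b => along X (fun h => (Y h : Matrix m m ℝ) a b) g, by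
    rw [mem_so]
    ext a b
    have h : ∀ h, (Y h : Matrix m m ℝ) b a = -(Y h : Matrix m m ℝ) a b := fun h =>
      congrFun (congrFun ((mem_so m ℝ _).1 (Y h).2) a) b
    simp [along, h]⟩

/-- The Lie bracket of vector fields in the left trivialization. The ambient matrix field of `Y` is
`g ↦ g * Y g`, and its derivative along `X` at `g` is `g * (X g * Y g + alongField X Y g)`; the
bracket is the difference of this expression and the one with `X` and `Y` exchanged. -/
def fieldBracket (X Y : SO m → so m ℝ) (g : SO m) : so m ℝ :=
  alongField X Y g - alongField Y X g + ⁅X g, Y g⁆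

theorem fieldBracket_const (A B : so m ℝ) :
    fieldBracket (fun _ : SO m => A) (fun _ => B) = fun _ => ⁅A, B⁆ := by
  funext g
  have h : ∀ A B : so m ℝ, alongField (fun _ : SO m => A) (fun _ => B) g = 0 := by
    intro A B
    ext a b
    simp [alongField, along]
  simp [fieldBracket, h]

theorem smoothField_const (A : so m ℝ) : SmoothField (fun _ : SO m => A) :=
  fun a b => ⟨fun _ => (A : Matrix m m ℝ) a b, contDiff_const, fun _ => rfl⟩

variable (m) in
/-- An affine connection on `SO(n)`: `D X Y` is the covariant derivative of `Y` along `X`. -/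
structure Connection where
  D : (SO m → so m ℝ) → (SO m → so m ℝ) → SO m → so m ℝ
  smooth : ∀ X Y, SmoothField X → SmoothField Y → SmoothField (D X Y)
  add_left : ∀ X X' Y, SmoothField X → SmoothField X' → SmoothField Y →
    D (X + X') Y = D X Y + D X' Y
  smul_left : ∀ (f : SO m → ℝ) X Y, SmoothFun f → SmoothField X → SmoothField Y →
    D (fun g => f g • X g) Y = fun g => f g • D X Y g
  add_right : ∀ X Y Y', SmoothField X → SmoothField Y → SmoothField Y' →
    D X (Y + Y') = D X Y + D X Y'
  leibniz : ∀ (f : SO m → ℝ) X Y, SmoothFun f → SmoothField X → SmoothField Y →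
    D X (fun g => f g • Y g) = fun g => f g • D X Y g + along X f g • Y g

namespace Connection

variable (C : Connection m)

/-- The connection is the Levi-Civita connection of the left-invariant metric whose value at the
identity is `β`, that is, of the metric `⟨g A, g B⟩_g = β A B`: it is torsion-free and metric. -/
structure IsLeviCivita (β : LinearMap.BilinForm ℝ (so m ℝ)) : Prop where
  torsion_free : ∀ X Y, SmoothField X → SmoothField Y →
    C.D X Y - C.D Y X = fieldBracket X Y
  metric : ∀ X Y Z, SmoothField X → SmoothField Y → SmoothField Z →
    along X (fun g => β (Y g) (Z g)) = fun g => β (C.D X Y g) (Z g) + β (Y g) (C.D X Z g)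

/-- The curvature `R(X, Y) Z = ∇_X ∇_Y Z - ∇_Y ∇_X Z - ∇_[X, Y] Z`. -/
def curvature (X Y Z : SO m → so m ℝ) : SO m → so m ℝ :=
  C.D X (C.D Y Z) - C.D Y (C.D X Z) - C.D (fieldBracket X Y) Z

theorem D_smul_right (X Y : SO m → so m ℝ) (c : ℝ) (hX : SmoothField X) (hY : SmoothField Y) :
    C.D X (c • Y) = c • C.D X Y := by
  have h := C.leibniz (fun _ => c) X Y ⟨fun _ => c, contDiff_const, fun _ => rfl⟩ hX hY
  refine h.trans ?_
  funext g
  simp [along]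

theorem D_smul_left (X Y : SO m → so m ℝ) (c : ℝ) (hX : SmoothField X) (hY : SmoothField Y) :
    C.D (c • X) Y = c • C.D X Y :=
  C.smul_left (fun _ => c) X Y ⟨fun _ => c, contDiff_const, fun _ => rfl⟩ hX hY

/-- The curvature is a tensor, so `R(g A, g V) (g W)` may be computed with any vector fields that
have these values at `g`; the left-invariant ones are used. This is the endomorphism
`A ↦ R(g A, g V) (g W)` of `T_g SO(n)`, in the left trivialization. -/
def curvatureEnd (g : SO m) (V W : so m ℝ) : so m ℝ →ₗ[ℝ] so m ℝ where
  toFun A := C.curvature (fun _ => A) (fun _ => V) (fun _ => W) g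
  map_add' A A' := by
    have s := fun B : so m ℝ => smoothField_const (m := m) B
    have e1 := C.add_left _ _ _ (s A) (s A') (C.smooth _ _ (s V) (s W))
    have e2 := C.add_left _ _ _ (s A) (s A') (s W)
    have e3 := C.add_right _ _ _ (s V) (C.smooth _ _ (s A) (s W)) (C.smooth _ _ (s A') (s W))
    have e4 := C.add_left _ _ _ (s ⁅A, V⁆) (s ⁅A', V⁆) (s W)
    rw [← e2] at e3
    simp only [curvature, fieldBracket_const, Pi.sub_apply, add_lie]
    have e1' := congrFun e1 g
    have e3' := congrFun e3 g
    have e4' := congrFun e4 g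
    simp only [Pi.add_apply] at e1' e3' e4'
    refine (congrArg₂ (· - ·) (congrArg₂ (· - ·) e1' e3') e4').trans ?_
    abel
  map_smul' c A := by
    have s := fun B : so m ℝ => smoothField_const (m := m) B
    have e1 := C.D_smul_left _ _ c (s A) (C.smooth _ _ (s V) (s W))
    have e2 := C.D_smul_left _ _ c (s A) (s W)
    have e3 := C.D_smul_right _ _ c (s V) (C.smooth _ _ (s A) (s W))
    have e4 := C.D_smul_left _ _ c (s ⁅A, V⁆) (s W)
    rw [← e2] at e3
    simp only [curvature, fieldBracket_const, Pi.sub_apply, smul_lie, RingHom.id_apply]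
    have e1' := congrFun e1 g
    have e3' := congrFun e3 g
    have e4' := congrFun e4 g
    refine (congrArg₂ (· - ·) (congrArg₂ (· - ·) e1' e3') e4').trans ?_
    simp only [Pi.smul_apply, smul_sub]

/-- The Ricci tensor `Ric_g(g V, g W)`, the trace of `A ↦ R(g A, g V) (g W)`. -/
def ricci (g : SO m) (V W : so m ℝ) : ℝ :=
  LinearMap.trace ℝ (so m ℝ) (C.curvatureEnd g V W)

end Connection

end Exponential

section Blocks

variable {p : ℕ} (k : Fin p → ℕ)

/-- Row and column indices of a matrix of size `k₁ + ⋯ + k_p`: `⟨i, a⟩` is the `a`-th index in the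
`i`-th block. -/
abbrev Idx : Type := (i : Fin p) × Fin (k i)

variable {k} in
/-- The entry in row `a` and column `b` lies in the `(i, j)` or in the `(j, i)` block. -/
def InBlock (i j : Fin p) (a b : Idx k) : Prop :=
  (a.1 = i ∧ b.1 = j) ∨ (a.1 = j ∧ b.1 = i)

/-- The skew-symmetric matrices that vanish outside the blocks `(i, j)` and `(j, i)`:
`block k i i` is `so(k_i)`, embedded diagonally, and `block k i j` is `m_ij` for `i ≠ j`. -/
def block (i j : Fin p) : Submodule ℝ (so (Idx k) ℝ) where
  carrier := {A | ∀ a b, ¬ InBlock i j a b → (A : Matrix (Idx k) (Idx k) ℝ) a b = 0}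
  add_mem' {A B} hA hB a b h := by simp [hA a b h, hB a b h]
  zero_mem' a b _ := by simp
  smul_mem' c A hA a b h := by simp [hA a b h]

open Classical in
/-- The projection of `so(n)` onto `block k i j` along the other blocks: all entries outside the
blocks `(i, j)` and `(j, i)` are replaced by `0`. -/
def blockProj (i j : Fin p) : so (Idx k) ℝ →ₗ[ℝ] so (Idx k) ℝ where
  toFun A := ⟨Matrix.of fun a b => if InBlock i j a b then (A : Matrix _ _ ℝ) a b else 0, by
    rw [mem_so]
    have hA : (A : Matrix (Idx k) (Idx k) ℝ)ᵀ = -A := (mem_so _ ℝ _).1 A.2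
    ext a b
    have hab : (A : Matrix (Idx k) (Idx k) ℝ) b a = -(A : Matrix (Idx k) (Idx k) ℝ) a b :=
      congrFun (congrFun hA a) b
    have hs : InBlock i j b a ↔ InBlock i j a b := by unfold InBlock; tauto
    simp only [Matrix.transpose_apply, Matrix.of_apply, Matrix.neg_apply, hs, hab]
    split_ifs <;> simp⟩
  map_add' A B := by
    ext a b
    by_cases h : InBlock i j a b <;> simp [h]
  map_smul' c A := by
    ext a b
    by_cases h : InBlock i j a b <;> simp [h]

/-- The bilinear form `(-B)|_{block k i j}` on `so(n)`, extended by `0` to the other blocks, where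
`B` is the Killing form of `so(n)`. -/
def negKillingOn (i j : Fin p) : LinearMap.BilinForm ℝ (so (Idx k) ℝ) :=
  (-killingForm ℝ (so (Idx k) ℝ)).comp (blockProj k i j) (blockProj k i j)

/-- The scalar product `∑ i, x_i (-B)|_{so(k_i)} + ∑ i < j, x_ij (-B)|_{m_ij}` on `so(n)`. -/
def diagMetric (x : Fin p → ℝ) (y : Fin p → Fin p → ℝ) :
    LinearMap.BilinForm ℝ (so (Idx k) ℝ) :=
  ∑ i, x i • negKillingOn k i i + ∑ i, ∑ j ∈ Finset.Ioi i, y i j • negKillingOn k i j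

variable {k} in
/-- The Ricci component on the submodule `V` is the number `r`: the Ricci tensor satisfies
`Ric(A, B) = r ⟨A, B⟩` at every point, for `A` in `V` and all `B`. -/
def IsRicciComponent (C : Connection (Idx k)) (β : LinearMap.BilinForm ℝ (so (Idx k) ℝ))
    (V : Submodule ℝ (so (Idx k) ℝ)) (r : ℝ) : Prop :=
  ∀ (g : SO (Idx k)), ∀ A ∈ V, ∀ B : so (Idx k) ℝ, C.ricci g A B = r * β A B

end Blocks

end SOGeometry

end

open scoped Matrix

noncomputable section

namespace SOGeometry

open Matrix LieAlgebra.Orthogonal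

/-! ### Matrix entries, traces and the Killing form on `so(n)` -/

section Elementary

variable {m : Type} [Fintype m] [DecidableEq m]

/-! Everything is computed in the elementary skew matrices E_ab. The Killing form is -(n-2) times
the entrywise inner product (`killingForm_so`), so the metric is diagonal in matrix entries, with
weight (n-2) w_ab, where w_ab depends only on the block of (a, b) (`isWeighted_diagMetric`).

For such a metric Koszul's formula gives ∇_{E_ab} E_bc = Γ_abc E_ac for distinct a, b, c, where
Γ_abc = (1 + (w_bc - w_ab) / w_ac) / 2. The bilinear map `nabla` built from these coefficients is
torsion-free and metric, hence agrees with any Levi-Civita connection on left-invariant fields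
(`D_const`).

In the trace of A ↦ R(A, V) W, replace [A, V] by ∇_A V - ∇_V A. The term tr(A ↦ ∇_A (∇_V W))
vanishes, two others cancel by cyclicity, and Ric(V, W) = -tr(A ↦ ∇_{∇_A V} W) remains (`ricci_eq`).
Evaluating this trace gives ∑ V_bc W_bc ρ_bc, where ρ_bc is the sum of Γ_abc Γ_acb over a ≠ b, c
when b ≠ c. So Ricci is diagonal in the entries too. Grouping a by blocks, with multiplicities k_l,
leaves a rational identity in the weights. -/

theorem so_apply_swap (A : so m ℝ) (a b : m) :
    (A : Matrix m m ℝ) b a = -(A : Matrix m m ℝ) a b :=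
  congrFun (congrFun ((mem_so m ℝ _).1 A.2) a) b

theorem so_apply_diag (A : so m ℝ) (a : m) : (A : Matrix m m ℝ) a a = 0 := by
  linarith [so_apply_swap A a a]

theorem so_add_apply (A B : so m ℝ) (a b : m) :
    ((A + B : so m ℝ) : Matrix m m ℝ) a b = (A : Matrix m m ℝ) a b + (B : Matrix m m ℝ) a b := rfl

theorem so_sub_apply (A B : so m ℝ) (a b : m) :
    ((A - B : so m ℝ) : Matrix m m ℝ) a b = (A : Matrix m m ℝ) a b - (B : Matrix m m ℝ) a b := rfl

theorem so_neg_apply (A : so m ℝ) (a b : m) :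
    ((-A : so m ℝ) : Matrix m m ℝ) a b = -(A : Matrix m m ℝ) a b := rfl

theorem so_smul_apply (r : ℝ) (A : so m ℝ) (a b : m) :
    ((r • A : so m ℝ) : Matrix m m ℝ) a b = r * (A : Matrix m m ℝ) a b := rfl

theorem so_lie_apply (A B : so m ℝ) (a b : m) :
    ((⁅A, B⁆ : so m ℝ) : Matrix m m ℝ) a b =
      ((A : Matrix m m ℝ) * (B : Matrix m m ℝ)) a b
        - ((B : Matrix m m ℝ) * (A : Matrix m m ℝ)) a b := rfl

/-- The skew-symmetric part of a square matrix. -/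
def skewPart : Matrix m m ℝ →ₗ[ℝ] so m ℝ where
  toFun M := ⟨(2⁻¹ : ℝ) • (M - Mᵀ), by
    rw [mem_so, transpose_smul, transpose_sub, transpose_transpose, ← smul_neg, neg_sub]⟩
  map_add' M N := by ext a b; simp; ring
  map_smul' c M := by ext a b; simp; ring

theorem skewPart_coe (A : so m ℝ) : skewPart (A : Matrix m m ℝ) = A := by
  ext a b
  simp only [skewPart, LinearMap.coe_mk, AddHom.coe_mk, Matrix.smul_apply, Matrix.sub_apply,
    Matrix.transpose_apply, so_apply_swap A a b, smul_eq_mul]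
  ring

/-- The skew-symmetric matrix with entry `1` in position `(a, b)` and `-1` in position `(b, a)`. -/
def elemSkew (a b : m) : so m ℝ :=
  ⟨Matrix.single a b 1 - Matrix.single b a 1, by
    rw [mem_so, transpose_sub, transpose_single, transpose_single, neg_sub]⟩

theorem elemSkew_apply (a b c d : m) :
    (elemSkew a b : Matrix m m ℝ) c d =
      (if a = c ∧ b = d then 1 else 0) - (if b = c ∧ a = d then 1 else 0) := by
  simp [elemSkew, Matrix.single_apply]

theorem elemSkew_swap (a b : m) : elemSkew b a = -elemSkew a b := by
  ext c d
  simp [elemSkew]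

theorem skewPart_single (a b : m) :
    skewPart (Matrix.single a b 1) = (2⁻¹ : ℝ) • elemSkew a b := by
  ext c d
  simp [skewPart, elemSkew]

/-- The trace of an endomorphism of the skew-symmetric matrices. -/
theorem trace_so (T : so m ℝ →ₗ[ℝ] so m ℝ) :
    LinearMap.trace ℝ (so m ℝ) T =
      2⁻¹ * ∑ a, ∑ b, (T (elemSkew a b) : Matrix m m ℝ) a b := by
  let incl : so m ℝ →ₗ[ℝ] Matrix m m ℝ :=
    { toFun := fun A => A, map_add' := fun _ _ => rfl, map_smul' := fun _ _ => rfl }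
  have h1 : T = (T ∘ₗ skewPart) ∘ₗ incl := by
    refine LinearMap.ext fun A => ?_
    exact (congrArg T (skewPart_coe A)).symm
  -- Cyclicity moves the trace to the space of all matrices, which has the standard basis. The skew
  -- part of a basis matrix is half of `elemSkew`, whence the factor 1/2.
  have h2 : LinearMap.trace ℝ (so m ℝ) T =
      LinearMap.trace ℝ (Matrix m m ℝ) (incl ∘ₗ (T ∘ₗ skewPart)) := by
    conv_lhs => rw [h1]
    exact LinearMap.trace_comp_comm' _ _
  rw [h2, LinearMap.trace_eq_matrix_trace ℝ (Matrix.stdBasis ℝ m m), Matrix.trace,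
    Fintype.sum_prod_type, Finset.mul_sum]
  refine Finset.sum_congr rfl fun a _ => ?_
  rw [Finset.mul_sum]
  refine Finset.sum_congr rfl fun b _ => ?_
  rw [Matrix.diag_apply, LinearMap.toMatrix_apply, Matrix.stdBasis_eq_single]
  change ((Matrix.stdBasis ℝ m m).repr ((T (skewPart (Matrix.single a b 1)) :
    Matrix m m ℝ))) (a, b) = _
  rw [skewPart_single, map_smul]
  rfl

/-- The correction at a = b is present because `elemSkew a a` is zero; it makes sums over all
ordered pairs legitimate. -/
theorem mul_elemSkew_apply (P : Matrix m m ℝ) (a b : m) :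
    (P * (elemSkew a b : Matrix m m ℝ)) a b = P a a - if a = b then P a a else 0 := by
  simp only [Matrix.mul_apply, elemSkew_apply, mul_sub, Finset.sum_sub_distrib]
  by_cases h : a = b
  · subst h; simp
  · simp [h]

theorem elemSkew_mul_apply (P : Matrix m m ℝ) (a b : m) :
    ((elemSkew a b : Matrix m m ℝ) * P) a b = P b b - if a = b then P a a else 0 := by
  simp only [Matrix.mul_apply, elemSkew_apply, sub_mul, Finset.sum_sub_distrib]
  by_cases h : a = b
  · subst h; simp
  · simp [h, Ne.symm h]

theorem mul_elemSkew_mul_apply (P Q : Matrix m m ℝ) (a b : m) :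
    (P * (elemSkew a b : Matrix m m ℝ) * Q) a b = P a a * Q b b - P a b * Q a b := by
  simp [elemSkew, mul_sub, sub_mul, Matrix.mul_apply, Matrix.single_apply, ite_and]

/-- Expand [A, [B, X]] = ABX - AXB - BXA + XBA and take the trace. With S the entrywise inner
product, tr(AB) = -S; the outer terms contribute -nS, the corrections at a = b contribute S, and the
two middle terms contribute S. -/
theorem killingForm_so (A B : so m ℝ) :
    killingForm ℝ (so m ℝ) A B =
      -((Fintype.card m : ℝ) - 2) *
        ∑ a, ∑ b, (A : Matrix m m ℝ) a b * (B : Matrix m m ℝ) a b := by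
  have hAB : ∀ a, ((A : Matrix m m ℝ) * (B : Matrix m m ℝ)) a a =
      -∑ b, (A : Matrix m m ℝ) a b * (B : Matrix m m ℝ) a b := by
    intro a
    rw [Matrix.mul_apply, ← Finset.sum_neg_distrib]
    refine Finset.sum_congr rfl fun b _ => ?_
    rw [so_apply_swap B a b]; ring
  have hBA : ∀ a, ((B : Matrix m m ℝ) * (A : Matrix m m ℝ)) a a =
      -∑ b, (A : Matrix m m ℝ) a b * (B : Matrix m m ℝ) a b := by
    intro a
    rw [Matrix.mul_apply, ← Finset.sum_neg_distrib]
    refine Finset.sum_congr rfl fun b _ => ?_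
    rw [so_apply_swap A a b]; ring
  have key : ∀ a b, (((LieAlgebra.ad ℝ (so m ℝ) A) ∘ₗ (LieAlgebra.ad ℝ (so m ℝ) B))
      (elemSkew a b) : Matrix m m ℝ) a b =
      ((A : Matrix m m ℝ) * (B : Matrix m m ℝ)) a a +
      ((B : Matrix m m ℝ) * (A : Matrix m m ℝ)) b b
      - (if a = b then ((A : Matrix m m ℝ) * (B : Matrix m m ℝ)) a a +
          ((B : Matrix m m ℝ) * (A : Matrix m m ℝ)) a a else 0)
      + 2 * ((A : Matrix m m ℝ) a b * (B : Matrix m m ℝ) a b) := by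
    intro a b
    have e : (((LieAlgebra.ad ℝ (so m ℝ) A) ∘ₗ (LieAlgebra.ad ℝ (so m ℝ) B))
      (elemSkew a b) : Matrix m m ℝ) =
        (A : Matrix m m ℝ) * (B : Matrix m m ℝ) * (elemSkew a b : Matrix m m ℝ)
        - (A : Matrix m m ℝ) * (elemSkew a b : Matrix m m ℝ) * (B : Matrix m m ℝ)
        - (B : Matrix m m ℝ) * (elemSkew a b : Matrix m m ℝ) * (A : Matrix m m ℝ)
        + (elemSkew a b : Matrix m m ℝ) * ((B : Matrix m m ℝ) * (A : Matrix m m ℝ)) := by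
      simp only [LinearMap.comp_apply, LieAlgebra.ad_apply, LieSubalgebra.coe_bracket,
        Ring.lie_def]
      noncomm_ring
    rw [e, Matrix.add_apply, Matrix.sub_apply, Matrix.sub_apply, mul_elemSkew_apply,
      mul_elemSkew_mul_apply, mul_elemSkew_mul_apply, elemSkew_mul_apply]
    simp only [so_apply_diag]
    split_ifs <;> ring
  rw [killingForm_apply_apply, trace_so]
  simp only [key, Finset.sum_add_distrib, Finset.sum_sub_distrib, Finset.sum_ite_eq,
    Finset.mem_univ, if_true, hAB, hBA, Finset.sum_const, Finset.card_univ, nsmul_eq_mul,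
    ← Finset.mul_sum, Finset.sum_neg_distrib]
  ring

end Elementary

/-! ### Levi-Civita connection and Ricci tensor of an entrywise diagonal metric -/

section LeviCivita

variable {m : Type}

/-- The coefficient of `E_ac` in the covariant derivative of `E_bc` along `E_ab`, for the
left-invariant metric in which the matrices `E_ab` are orthogonal with square lengths
proportional to `w a b`. -/
def christoffel (w : m → m → ℝ) (a b c : m) : ℝ := (1 + (w b c - w a b) / w a c) / 2

/-- This is the torsion-free condition at the level of coefficients. -/
theorem christoffel_add {w : m → m → ℝ} (hw : ∀ a b, w a b = w b a) (a b c : m) :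
    christoffel w a b c + christoffel w c b a = 1 := by
  simp only [christoffel, hw c b, hw c a, hw b a]
  ring

/-- Koszul's formula with the denominator cleared, the form in which metric compatibility becomes a
symmetry of the weights. -/
theorem mul_christoffel {w : m → m → ℝ} (hw0 : ∀ a b, 0 < w a b) (a b c : m) :
    w a c * christoffel w a b c = (w a c + w b c - w a b) / 2 := by
  have := (hw0 a c).ne'
  simp only [christoffel]
  field_simp
  ring

variable [Fintype m] [DecidableEq m]

/-- The covariant derivative of the left-invariant field `B` along the left-invariant field `A`. -/
def nabla (w : m → m → ℝ) : so m ℝ →ₗ[ℝ] so m ℝ →ₗ[ℝ] so m ℝ :=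
  LinearMap.mk₂ ℝ
    (fun A B => ⟨Matrix.of fun a c => ∑ b,
      ((A : Matrix m m ℝ) a b * (B : Matrix m m ℝ) b c * christoffel w a b c
        - (B : Matrix m m ℝ) a b * (A : Matrix m m ℝ) b c * christoffel w c b a), by
      rw [mem_so]
      ext a c
      simp only [Matrix.transpose_apply, Matrix.neg_apply, Matrix.of_apply,
        ← Finset.sum_neg_distrib]
      refine Finset.sum_congr rfl fun b _ => ?_
      rw [so_apply_swap A b c, so_apply_swap B b c, so_apply_swap A a b, so_apply_swap B a b]
      ring⟩)
    (fun A A' B => by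
      ext a c
      simp only [Matrix.of_apply, so_add_apply,
        ← Finset.sum_add_distrib]
      exact Finset.sum_congr rfl fun b _ => by ring)
    (fun r A B => by
      ext a c
      simp only [Matrix.of_apply, so_smul_apply,
        Finset.mul_sum]
      exact Finset.sum_congr rfl fun b _ => by ring)
    (fun A B B' => by
      ext a c
      simp only [Matrix.of_apply, so_add_apply,
        ← Finset.sum_add_distrib]
      exact Finset.sum_congr rfl fun b _ => by ring)
    (fun r A B => by
      ext a c
      simp only [Matrix.of_apply, so_smul_apply,
        Finset.mul_sum]
      exact Finset.sum_congr rfl fun b _ => by ring)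

theorem nabla_apply (w : m → m → ℝ) (A B : so m ℝ) (a c : m) :
    (nabla w A B : Matrix m m ℝ) a c = ∑ b,
      ((A : Matrix m m ℝ) a b * (B : Matrix m m ℝ) b c * christoffel w a b c
        - (B : Matrix m m ℝ) a b * (A : Matrix m m ℝ) b c * christoffel w c b a) := rfl

theorem nabla_sub_nabla {w : m → m → ℝ} (hw : ∀ a b, w a b = w b a) (A B : so m ℝ) :
    nabla w A B - nabla w B A = ⁅A, B⁆ := by
  ext a c
  rw [so_lie_apply, so_sub_apply, nabla_apply, nabla_apply, Matrix.mul_apply, Matrix.mul_apply,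
    ← Finset.sum_sub_distrib, ← Finset.sum_sub_distrib]
  refine Finset.sum_congr rfl fun b _ => ?_
  rw [eq_sub_of_add_eq (christoffel_add hw a b c)]
  ring

/-- The bilinear form `β` on `so(n)` is diagonal in the matrix entries, with weight `s * w a b` at
the entry `(a, b)`. -/
def IsWeighted (β : LinearMap.BilinForm ℝ (so m ℝ)) (s : ℝ) (w : m → m → ℝ) : Prop :=
  ∀ A B, β A B = s * ∑ a, ∑ b, w a b * ((A : Matrix m m ℝ) a b * (B : Matrix m m ℝ) a b)

theorem sum_weight_nabla {w : m → m → ℝ} (hw : ∀ a b, w a b = w b a) (hw0 : ∀ a b, 0 < w a b)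
    (A B C : so m ℝ) :
    ∑ a, ∑ c, w a c * ((nabla w A B : Matrix m m ℝ) a c * (C : Matrix m m ℝ) a c) =
      ∑ a, ∑ c, ∑ b, ((A : Matrix m m ℝ) a b * (B : Matrix m m ℝ) b c * (C : Matrix m m ℝ) a c *
        ((w a c + w b c - w a b) / 2)
        - (B : Matrix m m ℝ) a b * (A : Matrix m m ℝ) b c * (C : Matrix m m ℝ) a c *
        ((w a c + w a b - w b c) / 2)) := by
  refine Finset.sum_congr rfl fun a _ => Finset.sum_congr rfl fun c _ => ?_
  rw [nabla_apply, Finset.sum_mul, Finset.mul_sum]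
  refine Finset.sum_congr rfl fun b _ => ?_
  have h1 := mul_christoffel hw0 a b c
  have h2 := mul_christoffel hw0 c b a
  rw [hw c a, hw b a, hw c b] at h2
  rw [← h1, ← h2]
  ring

theorem IsWeighted.metric_nabla {β : LinearMap.BilinForm ℝ (so m ℝ)} {s : ℝ} {w : m → m → ℝ}
    (hβ : IsWeighted β s w) (hw : ∀ a b, w a b = w b a) (hw0 : ∀ a b, 0 < w a b)
    (A B C : so m ℝ) : β (nabla w A B) C + β B (nabla w A C) = 0 := by
  have hsymm : β B (nabla w A C) = β (nabla w A C) B := by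
    rw [hβ, hβ]
    simp only [mul_comm]
  rw [hsymm, hβ, hβ, sum_weight_nabla hw hw0, sum_weight_nabla hw hw0, ← mul_add]
  simp only [Finset.sum_sub_distrib]
  -- Exchange a and b: A_ab changes sign while the weight factor is symmetric. The second identity
  -- is the same with b and c exchanged.
  have e1 : ∑ a, ∑ c, ∑ b, (A : Matrix m m ℝ) a b * (C : Matrix m m ℝ) b c *
      (B : Matrix m m ℝ) a c * ((w a c + w b c - w a b) / 2) =
      -∑ a, ∑ c, ∑ b, (A : Matrix m m ℝ) a b * (B : Matrix m m ℝ) b c *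
      (C : Matrix m m ℝ) a c * ((w a c + w b c - w a b) / 2) := by
    rw [Finset.sum_comm]
    conv_rhs => rw [Finset.sum_comm]
    rw [← Finset.sum_neg_distrib]
    refine Finset.sum_congr rfl fun c _ => ?_
    rw [Finset.sum_comm, ← Finset.sum_neg_distrib]
    refine Finset.sum_congr rfl fun a _ => ?_
    rw [← Finset.sum_neg_distrib]
    refine Finset.sum_congr rfl fun b _ => ?_
    rw [so_apply_swap A a b, hw b a]
    ring
  have e2 : ∑ a, ∑ c, ∑ b, (C : Matrix m m ℝ) a b * (A : Matrix m m ℝ) b c *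
      (B : Matrix m m ℝ) a c * ((w a c + w a b - w b c) / 2) =
      -∑ a, ∑ c, ∑ b, (B : Matrix m m ℝ) a b * (A : Matrix m m ℝ) b c *
      (C : Matrix m m ℝ) a c * ((w a c + w a b - w b c) / 2) := by
    rw [← Finset.sum_neg_distrib]
    refine Finset.sum_congr rfl fun a _ => ?_
    rw [Finset.sum_comm, ← Finset.sum_neg_distrib]
    refine Finset.sum_congr rfl fun c _ => ?_
    rw [← Finset.sum_neg_distrib]
    refine Finset.sum_congr rfl fun b _ => ?_
    rw [so_apply_swap A b c, hw c b]
    ring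
  rw [e1, e2]
  ring

theorem IsWeighted.eq_zero {β : LinearMap.BilinForm ℝ (so m ℝ)} {s : ℝ} {w : m → m → ℝ}
    (hβ : IsWeighted β s w) (hs : 0 < s) (hw0 : ∀ a b, 0 < w a b) {A : so m ℝ}
    (hA : β A A = 0) : A = 0 := by
  have h0 : ∀ a b, 0 ≤ w a b * ((A : Matrix m m ℝ) a b * (A : Matrix m m ℝ) a b) := fun a b =>
    mul_nonneg (hw0 a b).le (mul_self_nonneg _)
  rw [hβ, mul_eq_zero, or_iff_right hs.ne',
    Finset.sum_eq_zero_iff_of_nonneg fun a _ => Finset.sum_nonneg fun b _ => h0 a b] at hA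
  ext a b
  have h := (Finset.sum_eq_zero_iff_of_nonneg fun b _ => h0 a b).1 (hA a (Finset.mem_univ a)) b
    (Finset.mem_univ b)
  rw [mul_eq_zero, or_iff_right (hw0 a b).ne', mul_self_eq_zero] at h
  exact h

/-- The Levi-Civita connection is determined on left-invariant fields. -/
theorem Connection.IsLeviCivita.D_const {C : Connection m} {β : LinearMap.BilinForm ℝ (so m ℝ)}
    (hC : C.IsLeviCivita β) {s : ℝ} {w : m → m → ℝ} (hβ : IsWeighted β s w) (hs : 0 < s)
    (hw : ∀ a b, w a b = w b a) (hw0 : ∀ a b, 0 < w a b) (A B : so m ℝ) :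
    C.D (fun _ => A) (fun _ => B) = fun _ => nabla w A B := by
  funext g
  -- The difference of two connections; torsion-freeness makes it symmetric, metricity makes it skew
  -- with respect to `β`.
  let S : so m ℝ → so m ℝ → so m ℝ := fun A B =>
    C.D (fun _ => A) (fun _ => B) g - nabla w A B
  have hsymm : ∀ A B, S A B = S B A := by
    intro A B
    have h1 := congrFun (hC.torsion_free (fun _ => A) (fun _ => B) (smoothField_const A)
      (smoothField_const B)) g
    rw [fieldBracket_const, Pi.sub_apply, ← nabla_sub_nabla hw] at h1
    rw [sub_eq_sub_iff_add_eq_add] at h1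
    simp only [S]
    rw [sub_eq_sub_iff_add_eq_add, h1, add_comm]
  have hskew : ∀ A B E, β (S A B) E + β B (S A E) = 0 := by
    intro A B E
    have h1 := congrFun (hC.metric (fun _ => A) (fun _ => B) (fun _ => E) (smoothField_const A)
      (smoothField_const B) (smoothField_const E)) g
    have h2 := hβ.metric_nabla hw hw0 A B E
    simp only [along, deriv_const] at h1
    simp only [S, map_sub, LinearMap.sub_apply]
    linarith
  have hβs : ∀ A B, β A B = β B A := by
    intro A B
    rw [hβ, hβ]
    simp only [mul_comm]
  -- A trilinear form symmetric in its first two slots and skew in its last two vanishes: the three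
  -- cyclic values have pairwise sums zero.
  have hzero : ∀ A B E, β (S A B) E = 0 := by
    intro A B E
    have h1 := hskew A B E
    have h2 := hskew B E A
    have h3 := hskew E A B
    rw [hβs B, hsymm A E] at h1
    rw [hβs E, hsymm B A] at h2
    rw [hβs A, hsymm E B] at h3
    linarith
  exact sub_eq_zero.1 (hβ.eq_zero hs hw0 (hzero A B (S A B)))

/-- Left-invariant fields are divergence-free: the (a, b) entry of the derivative along E_ab
involves only diagonal entries of U, which are zero. -/
theorem trace_nabla_left (w : m → m → ℝ) (U : so m ℝ) :
    LinearMap.trace ℝ (so m ℝ) ((nabla w).flip U) = 0 := by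
  rw [trace_so]
  have h : ∀ a b, ((nabla w).flip U (elemSkew a b) : Matrix m m ℝ) a b = 0 := by
    intro a b
    rw [LinearMap.flip_apply, nabla_apply]
    refine Finset.sum_eq_zero fun c _ => ?_
    simp only [elemSkew_apply]
    by_cases h1 : b = c
    · subst h1
      by_cases h2 : a = b <;> simp [h2, so_apply_diag]
    · by_cases h2 : a = c
      · subst h2
        simp [h1, Ne.symm h1, so_apply_diag]
      · simp [h1, h2]
  simp only [h, Finset.sum_const_zero, mul_zero]

theorem nabla_elemSkew_apply (w : m → m → ℝ) (V : so m ℝ)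
    (a b c : m) :
    (nabla w (elemSkew a b) V : Matrix m m ℝ) a c =
      (V : Matrix m m ℝ) b c * christoffel w a b c
        - (if a = b then (V : Matrix m m ℝ) a c * christoffel w a a c else 0)
        + (if a = c then (V : Matrix m m ℝ) a b * christoffel w a b a else 0) := by
  have h : ∀ d, (elemSkew a b : Matrix m m ℝ) a d * (V : Matrix m m ℝ) d c * christoffel w a d c
      - (V : Matrix m m ℝ) a d * (elemSkew a b : Matrix m m ℝ) d c * christoffel w c d a =
      (if b = d then (V : Matrix m m ℝ) d c * christoffel w a d c else 0)
        - (if a = d then if a = b then (V : Matrix m m ℝ) d c * christoffel w a d c else 0 else 0)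
        + (if b = d then if a = c then (V : Matrix m m ℝ) a d * christoffel w a d a else 0
            else 0) := by
    intro d
    simp only [elemSkew_apply]
    by_cases h1 : a = d
    · subst h1
      by_cases h2 : a = b
      · subst h2
        by_cases h3 : a = c <;> simp [h3, so_apply_diag]
      · simp [h2, Ne.symm h2, so_apply_diag]
    · by_cases h2 : b = d
      · subst h2
        by_cases h3 : a = c
        · subst h3; simp [h1, Ne.symm h1]
        · simp [h1, h3]
      · simp [h1, h2]
  rw [nabla_apply, Finset.sum_congr rfl fun d _ => h d]
  simp only [Finset.sum_add_distrib, Finset.sum_sub_distrib, Finset.sum_ite_eq, Finset.mem_univ,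
    if_true]

/-- Generically the entry (a, c) of ∇_{E_ab} V is V_bc Γ_abc, and a second derivative returns it to
(a, b) with factor W_cb Γ_acb = -W_bc Γ_acb. The subtracted terms are the degenerate cases a = b and
a = c. -/
theorem trace_nabla_comp_nabla (w : m → m → ℝ)
    (V W : so m ℝ) :
    LinearMap.trace ℝ (so m ℝ) ((nabla w).flip W ∘ₗ (nabla w).flip V) =
      -∑ b, ∑ c, (V : Matrix m m ℝ) b c * (W : Matrix m m ℝ) b c *
        (∑ a, christoffel w a b c * christoffel w a c b
          - christoffel w b b c * christoffel w b c b
          - christoffel w c b c * christoffel w c c b) := by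
  -- The two halves of `nabla` contribute equally, by exchanging a and b; the resulting 2 cancels
  -- the 1/2 of `trace_so`.
  have h1 : ∑ a, ∑ b, (((nabla w).flip W ∘ₗ (nabla w).flip V) (elemSkew a b) :
      Matrix m m ℝ) a b =
      2 * ∑ a, ∑ b, ∑ c, (nabla w (elemSkew a b) V : Matrix m m ℝ) a c *
        (W : Matrix m m ℝ) c b * christoffel w a c b := by
    simp only [LinearMap.comp_apply, LinearMap.flip_apply]
    simp only [nabla_apply w _ W, Finset.sum_sub_distrib]
    rw [two_mul, sub_eq_add_neg]
    congr 1
    rw [Finset.sum_comm, ← Finset.sum_neg_distrib]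
    refine Finset.sum_congr rfl fun a _ => ?_
    rw [← Finset.sum_neg_distrib]
    refine Finset.sum_congr rfl fun b _ => ?_
    rw [← Finset.sum_neg_distrib]
    refine Finset.sum_congr rfl fun c _ => ?_
    rw [elemSkew_swap, map_neg, LinearMap.neg_apply, so_neg_apply, so_apply_swap _ a c,
      so_apply_swap W c b]
    ring
  have h2 : ∀ a b, ∑ c, (nabla w (elemSkew a b) V : Matrix m m ℝ) a c *
        (W : Matrix m m ℝ) c b * christoffel w a c b =
      ∑ c, (-((V : Matrix m m ℝ) b c * (W : Matrix m m ℝ) b c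
          * (christoffel w a b c * christoffel w a c b))
        + (if a = b then (V : Matrix m m ℝ) a c * (W : Matrix m m ℝ) a c *
            (christoffel w a a c * christoffel w a c a) else 0)
        + (if a = c then (V : Matrix m m ℝ) a b * (W : Matrix m m ℝ) a b *
            (christoffel w a b a * christoffel w a a b) else 0)) := by
    intro a b
    refine Finset.sum_congr rfl fun c _ => ?_
    rw [nabla_elemSkew_apply, so_apply_swap W b c]
    split_ifs with h h' h'
    · subst h; subst h'; simp [so_apply_diag]
    · subst h; ring
    · subst h'; rw [so_apply_swap W a b]; ring
    · ring
  have h3 : ∑ a, ∑ b, ∑ c, (V : Matrix m m ℝ) b c * (W : Matrix m m ℝ) b c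
          * (christoffel w a b c * christoffel w a c b) =
      ∑ b, ∑ c, (V : Matrix m m ℝ) b c * (W : Matrix m m ℝ) b c
          * ∑ a, christoffel w a b c * christoffel w a c b := by
    rw [Finset.sum_comm]
    refine Finset.sum_congr rfl fun b _ => ?_
    rw [Finset.sum_comm]
    refine Finset.sum_congr rfl fun c _ => ?_
    rw [Finset.mul_sum]
  have h4 : ∑ a, ∑ b, ∑ c, (if a = b then (V : Matrix m m ℝ) a c * (W : Matrix m m ℝ) a c *
            (christoffel w a a c * christoffel w a c a) else 0) =
      ∑ b, ∑ c, (V : Matrix m m ℝ) b c * (W : Matrix m m ℝ) b c *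
        (christoffel w b b c * christoffel w b c b) := by
    refine Finset.sum_congr rfl fun a _ => ?_
    rw [Finset.sum_comm]
    simp only [Finset.sum_ite_eq, Finset.mem_univ, if_true]
  have h5 : ∑ a, ∑ b, ∑ c, (if a = c then (V : Matrix m m ℝ) a b * (W : Matrix m m ℝ) a b *
            (christoffel w a b a * christoffel w a a b) else 0) =
      ∑ b, ∑ c, (V : Matrix m m ℝ) b c * (W : Matrix m m ℝ) b c *
        (christoffel w c b c * christoffel w c c b) := by
    simp only [Finset.sum_ite_eq, Finset.mem_univ, if_true]
    rw [Finset.sum_comm]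
    refine Finset.sum_congr rfl fun b _ => Finset.sum_congr rfl fun c _ => ?_
    rw [so_apply_swap V b c, so_apply_swap W b c]
    ring
  rw [trace_so, h1, Finset.sum_congr rfl fun a _ => Finset.sum_congr rfl fun b _ => h2 a b]
  simp only [Finset.sum_add_distrib, Finset.sum_neg_distrib]
  rw [h3, h4, h5]
  simp only [mul_sub, Finset.sum_sub_distrib]
  ring

theorem Connection.IsLeviCivita.ricci_eq {C : Connection m}
    {β : LinearMap.BilinForm ℝ (so m ℝ)}
    (hC : C.IsLeviCivita β) {s : ℝ} {w : m → m → ℝ} (hβ : IsWeighted β s w) (hs : 0 < s)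
    (hw : ∀ a b, w a b = w b a) (hw0 : ∀ a b, 0 < w a b) (g : SO m) (V W : so m ℝ) :
    C.ricci g V W = ∑ b, ∑ c, (V : Matrix m m ℝ) b c * (W : Matrix m m ℝ) b c *
        (∑ a, christoffel w a b c * christoffel w a c b
          - christoffel w b b c * christoffel w b c b
          - christoffel w c b c * christoffel w c c b) := by
  -- Torsion-freeness expresses the bracket through `nabla`, so each term is a composition whose
  -- trace is accessible.
  have h : C.curvatureEnd g V W = (nabla w).flip (nabla w V W)
      - nabla w V ∘ₗ (nabla w).flip W
      - (nabla w).flip W ∘ₗ ((nabla w).flip V - nabla w V) := by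
    refine LinearMap.ext fun A => ?_
    change C.curvature (fun _ => A) (fun _ => V) (fun _ => W) g = _
    simp only [Connection.curvature, fieldBracket_const, hC.D_const hβ hs hw hw0, Pi.sub_apply]
    simp only [← nabla_sub_nabla hw A V, LinearMap.sub_apply, LinearMap.comp_apply,
      LinearMap.flip_apply]
  rw [Connection.ricci, h, LinearMap.comp_sub, map_sub, map_sub, map_sub, trace_nabla_left,
    LinearMap.trace_comp_comm', trace_nabla_comp_nabla w]
  ring

end LeviCivita

/-! ### The block metric as an entrywise diagonal metric -/

section BlockMetric

variable {p : ℕ}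

/-- The weight of the entries in the block `(i, j)`. -/
def blockWeight (x : Fin p → ℝ) (y : Fin p → Fin p → ℝ) (i j : Fin p) : ℝ :=
  if i = j then x i else y i j

theorem blockWeight_self (x : Fin p → ℝ) (y : Fin p → Fin p → ℝ) (i : Fin p) :
    blockWeight x y i i = x i := if_pos rfl

theorem blockWeight_of_ne (x : Fin p → ℝ) (y : Fin p → Fin p → ℝ) {i j : Fin p} (h : i ≠ j) :
    blockWeight x y i j = y i j := if_neg h

theorem blockWeight_symm (x : Fin p → ℝ) {y : Fin p → Fin p → ℝ} (hsymm : ∀ i j, y i j = y j i)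
    (i j : Fin p) : blockWeight x y i j = blockWeight x y j i := by
  by_cases h : i = j
  · rw [h]
  · rw [blockWeight_of_ne x y h, blockWeight_of_ne x y (Ne.symm h), hsymm]

theorem blockWeight_pos {x : Fin p → ℝ} (hx : ∀ i, 0 < x i) {y : Fin p → Fin p → ℝ}
    (hy : ∀ i j, i ≠ j → 0 < y i j) (i j : Fin p) : 0 < blockWeight x y i j := by
  by_cases h : i = j
  · rw [h, blockWeight_self]; exact hx j
  · rw [blockWeight_of_ne x y h]; exact hy i j h

variable (k : Fin p → ℕ)

open Classical in
theorem negKillingOn_apply (i j : Fin p) (A B : so (Idx k) ℝ) :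
    negKillingOn k i j A B = ((∑ l, (k l : ℝ)) - 2) * ∑ a, ∑ b,
      (if InBlock i j a b then 1 else 0) *
        ((A : Matrix (Idx k) (Idx k) ℝ) a b * (B : Matrix (Idx k) (Idx k) ℝ) a b) := by
  have h : negKillingOn k i j A B =
      -killingForm ℝ (so (Idx k) ℝ) (blockProj k i j A) (blockProj k i j B) := rfl
  have hA : ∀ (A : so (Idx k) ℝ) a b, (blockProj k i j A : Matrix (Idx k) (Idx k) ℝ) a b =
      if InBlock i j a b then (A : Matrix (Idx k) (Idx k) ℝ) a b else 0 := fun _ _ _ => rfl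
  rw [h, killingForm_so, Fintype.card_sigma]
  simp only [hA, Fintype.card_fin, Nat.cast_sum, neg_mul, neg_neg]
  congr 1
  refine Finset.sum_congr rfl fun a _ => Finset.sum_congr rfl fun b _ => ?_
  split_ifs <;> simp

open Classical in
-- Each entry lies in exactly one of the blocks (i, i) or (i, j) with i < j. Symmetry of `y` handles
-- the entries below the diagonal.
theorem sum_inBlock (x : Fin p → ℝ) {y : Fin p → Fin p → ℝ} (hsymm : ∀ i j, y i j = y j i)
    (a b : Idx k) :
    (∑ i, x i * (if InBlock i i a b then 1 else 0))
      + ∑ i, ∑ j ∈ Finset.Ioi i, y i j * (if InBlock i j a b then 1 else 0) =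
      blockWeight x y a.1 b.1 := by
  have h1 : ∀ i, x i * (if InBlock i i a b then 1 else 0) =
      if a.1 = i then if a.1 = b.1 then x i else 0 else 0 := by
    intro i
    unfold InBlock
    by_cases h : a.1 = i
    · subst h
      by_cases h' : a.1 = b.1
      · simp [h']
      · simp [h', Ne.symm h']
    · simp [h]
  have h2 : ∀ i, ∑ j ∈ Finset.Ioi i, y i j * (if InBlock i j a b then 1 else 0) =
      (if a.1 = i then if a.1 < b.1 then y a.1 b.1 else 0 else 0)
        + (if b.1 = i then if b.1 < a.1 then y a.1 b.1 else 0 else 0) := by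
    intro i
    have h3 : ∀ j ∈ Finset.Ioi i, y i j * (if InBlock i j a b then 1 else 0) =
        (if b.1 = j then if a.1 = i then y a.1 b.1 else 0 else 0)
        + (if a.1 = j then if b.1 = i then y a.1 b.1 else 0 else 0) := by
      intro j hj
      have hij : i ≠ j := (Finset.mem_Ioi.1 hj).ne
      unfold InBlock
      by_cases ha : a.1 = i
      · have ha' : a.1 ≠ j := ha ▸ hij
        by_cases hb : b.1 = j <;> simp [ha, hb, hij]
      · by_cases ha' : a.1 = j
        · by_cases hb : b.1 = i <;> simp [ha', hb, hij, hij.symm, hsymm i j]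
        · simp [ha, ha']
    rw [Finset.sum_congr rfl h3, Finset.sum_add_distrib, Finset.sum_ite_eq, Finset.sum_ite_eq]
    simp only [Finset.mem_Ioi]
    congr 1
    · by_cases h : a.1 = i
      · subst h; simp
      · simp [h]
    · by_cases h : b.1 = i
      · subst h; simp
      · simp [h]
  simp only [h1, h2, Finset.sum_add_distrib, Finset.sum_ite_eq, Finset.mem_univ, if_true]
  rcases lt_trichotomy a.1 b.1 with h | h | h
  · simp [blockWeight, h, h.ne, h.not_gt]
  · simp [blockWeight, h]
  · simp [blockWeight, h, h.ne', h.not_gt]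

theorem isWeighted_diagMetric (x : Fin p → ℝ) {y : Fin p → Fin p → ℝ}
    (hsymm : ∀ i j, y i j = y j i) :
    IsWeighted (diagMetric k x y) ((∑ l, (k l : ℝ)) - 2)
      (fun a b => blockWeight x y a.1 b.1) := by
  classical
  intro A B
  have h : diagMetric k x y A B = (∑ i, x i * negKillingOn k i i A B)
      + ∑ i, ∑ j ∈ Finset.Ioi i, y i j * negKillingOn k i j A B := by
    simp only [diagMetric, LinearMap.add_apply, LinearMap.sum_apply, LinearMap.smul_apply,
      smul_eq_mul]
  have e : ∀ i j (c : ℝ), c * negKillingOn k i j A B = ((∑ l, (k l : ℝ)) - 2) * ∑ a, ∑ b,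
      c * (if InBlock i j a b then 1 else 0) *
        ((A : Matrix (Idx k) (Idx k) ℝ) a b * (B : Matrix (Idx k) (Idx k) ℝ) a b) := by
    intro i j c
    rw [negKillingOn_apply]
    simp only [mul_assoc, ← Finset.mul_sum]
    ring
  rw [h]
  simp only [e, ← Finset.mul_sum, ← mul_add]
  congr 1
  simp only [← sum_inBlock k x hsymm, add_mul, Finset.sum_add_distrib, Finset.sum_mul]
  congr 1
  · rw [Finset.sum_comm]
    exact Finset.sum_congr rfl fun a _ => Finset.sum_comm
  · have s1 : ∀ i, ∑ j ∈ Finset.Ioi i, ∑ a, ∑ b, y i j * (if InBlock i j a b then 1 else 0) *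
        ((A : Matrix (Idx k) (Idx k) ℝ) a b * (B : Matrix (Idx k) (Idx k) ℝ) a b) =
        ∑ a, ∑ b, ∑ j ∈ Finset.Ioi i, y i j * (if InBlock i j a b then 1 else 0) *
        ((A : Matrix (Idx k) (Idx k) ℝ) a b * (B : Matrix (Idx k) (Idx k) ℝ) a b) := by
      intro i
      rw [Finset.sum_comm]
      exact Finset.sum_congr rfl fun a _ => Finset.sum_comm
    simp only [s1]
    rw [Finset.sum_comm]
    exact Finset.sum_congr rfl fun a _ => Finset.sum_comm

/-- A number is the Ricci component on a block as soon as it satisfies a scalar identity. -/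
theorem isRicciComponent_block (hk : 2 < ∑ l, (k l : ℝ))
    {x : Fin p → ℝ} (hx : ∀ i, 0 < x i) {y : Fin p → Fin p → ℝ}
    (hy : ∀ i j, i ≠ j → 0 < y i j) (hsymm : ∀ i j, y i j = y j i)
    {C : Connection (Idx k)} (hC : C.IsLeviCivita (diagMetric k x y)) (i j : Fin p) (r : ℝ)
    (hr : ∀ u, u = christoffel (blockWeight x y) →
      ∑ l, k l * (u l i j * u l j i) - u i i j * u i j i - u j i j * u j j i =
        r * ((∑ l, (k l : ℝ)) - 2) * blockWeight x y i j) :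
    IsRicciComponent C (diagMetric k x y) (block k i j) r := by
  intro g A hA B
  have hw := isWeighted_diagMetric k x hsymm
  rw [hC.ricci_eq hw (sub_pos.2 hk) (fun a b => blockWeight_symm x hsymm a.1 b.1)
    (fun a b => blockWeight_pos hx hy a.1 b.1), hw, ← mul_assoc, Finset.mul_sum]
  refine Finset.sum_congr rfl fun b _ => ?_
  rw [Finset.mul_sum]
  refine Finset.sum_congr rfl fun c _ => ?_
  by_cases hbc : InBlock i j b c
  · have hr' := hr _ rfl
    -- The coefficients see only the block of a, and block l contains `k l` indices.
    have hsum : ∑ a : Idx k, christoffel (blockWeight x y) a.1 i j *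
        christoffel (blockWeight x y) a.1 j i = ∑ l, k l * (christoffel (blockWeight x y) l i j *
        christoffel (blockWeight x y) l j i) := by
      rw [Fintype.sum_sigma]
      simp
    rw [← hsum] at hr'
    have hcoef : ∑ a : Idx k, christoffel (blockWeight x y) a.1 b.1 c.1 *
          christoffel (blockWeight x y) a.1 c.1 b.1
        - christoffel (blockWeight x y) b.1 b.1 c.1 * christoffel (blockWeight x y) b.1 c.1 b.1
        - christoffel (blockWeight x y) c.1 b.1 c.1 * christoffel (blockWeight x y) c.1 c.1 b.1 =
        r * ((∑ l, (k l : ℝ)) - 2) * blockWeight x y b.1 c.1 := by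
      rcases hbc with ⟨rfl, rfl⟩ | ⟨rfl, rfl⟩
      · exact hr'
      · rw [blockWeight_symm x hsymm b.1, ← hr']
        simp only [mul_comm]
        ring
    change _ * (∑ a : Idx k, christoffel (blockWeight x y) a.1 b.1 c.1 *
          christoffel (blockWeight x y) a.1 c.1 b.1
        - christoffel (blockWeight x y) b.1 b.1 c.1 * christoffel (blockWeight x y) b.1 c.1 b.1
        - christoffel (blockWeight x y) c.1 b.1 c.1 * christoffel (blockWeight x y) c.1 c.1 b.1)
        = _
    rw [hcoef]
    ring
  · simp [hA b c hbc]

end BlockMetric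

end SOGeometry

end

/-! ### The Ricci components from scalar identities -/

theorem proposition5p4 (p : ℕ) (k : Fin p → ℕ) (hk : ∀ i, 3 ≤ k i)
    (x : Fin p → ℝ) (hx : ∀ i, 0 < x i)
    (y : Fin p → Fin p → ℝ) (hy : ∀ i j, i ≠ j → 0 < y i j) (hsymm : ∀ i j, y i j = y j i)
    (n : ℝ) (hn : n = ∑ i, (k i : ℝ))
    (C : SOGeometry.Connection (SOGeometry.Idx k))
    (hC : C.IsLeviCivita (SOGeometry.diagMetric k x y)) :
    (∀ i, SOGeometry.IsRicciComponent C (SOGeometry.diagMetric k x y) (SOGeometry.block k i i)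
      ((k i - 2) / (4 * (n - 2) * x i)
        + 1 / (4 * (n - 2)) * ∑ j with j ≠ i, k j * (x i / y i j ^ 2))) ∧
    (∀ i j, i < j →
      SOGeometry.IsRicciComponent C (SOGeometry.diagMetric k x y) (SOGeometry.block k i j)
        (1 / (2 * y i j)
          + ∑ l with l ≠ i ∧ l ≠ j, k l / (4 * (n - 2)) *
              (y i j / (y i l * y j l) - y i l / (y i j * y j l) - y j l / (y i j * y i l))
          - (k i - 1) / (4 * (n - 2)) * (x i / y i j ^ 2)
          - (k j - 1) / (4 * (n - 2)) * (x j / y i j ^ 2))) := by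
  -- The bound needs an index, since n = 0 when p = 0.
  have hn2 : ∀ i : Fin p, 2 < n := by
    intro i
    have h1 : (k i : ℝ) ≤ n :=
      hn ▸ Finset.single_le_sum (f := fun l => (k l : ℝ)) (fun l _ => Nat.cast_nonneg _)
        (Finset.mem_univ i)
    have h2 : (3 : ℝ) ≤ k i := by exact_mod_cast hk i
    linarith
  refine ⟨fun i => ?_, fun i j hij => ?_⟩
  · have hni := hn2 i
    have hn0 : n - 2 ≠ 0 := by linarith
    have hxi := (hx i).ne'
    refine SOGeometry.isRicciComponent_block k (hn ▸ hni) hx hy hsymm hC i i _ fun u hu => ?_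
    -- Of the `k i` terms with l = i, two are removed by the degenerate cases; each is 1/4, which
    -- gives (k_i - 2) / 4.
    have hi : u i i i = 1 / 2 := by
      rw [hu, SOGeometry.christoffel]
      simp
    have hl : ∀ l, l ≠ i → k l * (u l i i * u l i i) =
        x i / 4 * (k l * (x i / y i l ^ 2)) := by
      intro l hl
      have h0 := (hy i l hl.symm).ne'
      rw [hu, SOGeometry.christoffel, SOGeometry.blockWeight_self,
        SOGeometry.blockWeight_of_ne x y hl, hsymm l i]
      field_simp
      ring
    have hfilter : Finset.univ.filter (fun l => l ≠ i) = Finset.univ.erase i := by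
      ext l; simp
    rw [← hn, SOGeometry.blockWeight_self, hi, ← Finset.add_sum_erase _ _ (Finset.mem_univ i), hi,
      hfilter,
      Finset.sum_congr rfl fun l hm => hl l (Finset.ne_of_mem_erase hm), ← Finset.mul_sum]
    generalize ∑ l ∈ Finset.univ.erase i, (k l : ℝ) * (x i / y i l ^ 2) = S
    field_simp
    ring
  · have hni := hn2 i
    have hn0 : n - 2 ≠ 0 := by linarith
    have hne := hij.ne
    have hy0 := (hy i j hne).ne'
    have hxi := (hx i).ne'
    have hxj := (hx j).ne'
    refine SOGeometry.isRicciComponent_block k (hn ▸ hni) hx hy hsymm hC i j _ fun u hu => ?_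
    -- One of the `k i` equal terms is removed as degenerate, whence the factor k_i - 1; likewise
    -- for j.
    have hi : u i i j * u i j i = (2 - x i / y i j) / 4 := by
      rw [hu, SOGeometry.christoffel, SOGeometry.christoffel, SOGeometry.blockWeight_of_ne x y hne,
        SOGeometry.blockWeight_of_ne x y hne.symm,
        SOGeometry.blockWeight_self, hsymm j i]
      field_simp
      ring
    have hj : u j i j * u j j i = (2 - x j / y i j) / 4 := by
      rw [hu, SOGeometry.christoffel, SOGeometry.christoffel, SOGeometry.blockWeight_of_ne x y hne,
        SOGeometry.blockWeight_of_ne x y hne.symm,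
        SOGeometry.blockWeight_self, hsymm j i]
      field_simp
      ring
    -- The constants 1/2 here and in `hi`, `hj` add up to (n - k_i - k_j)/2 + (k_i - 1)/2 + (k_j -
    -- 1)/2 = (n - 2)/2, the source of the term 1 / (2 y_ij).
    have hl : ∀ l, l ≠ i ∧ l ≠ j → k l * (u l i j * u l j i) =
        y i j * (n - 2) * (k l / (4 * (n - 2)) *
          (y i j / (y i l * y j l) - y i l / (y i j * y j l) - y j l / (y i j * y i l)))
        + 1 / 2 * k l := by
      rintro l ⟨h1, h2⟩
      have h3 := (hy i l h1.symm).ne'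
      have h4 := (hy j l h2.symm).ne'
      rw [hu, SOGeometry.christoffel, SOGeometry.christoffel, SOGeometry.blockWeight_of_ne x y hne,
        SOGeometry.blockWeight_of_ne x y hne.symm,
        SOGeometry.blockWeight_of_ne x y h1, SOGeometry.blockWeight_of_ne x y h2, hsymm j i,
        hsymm l i, hsymm l j]
      field_simp
      ring
    have hsplit : ∀ f : Fin p → ℝ, ∑ l, f l = f i + f j + ∑ l with l ≠ i ∧ l ≠ j, f l := by
      intro f
      have hfilter : Finset.univ.filter (fun l => l ≠ i ∧ l ≠ j) =
          (Finset.univ.erase i).erase j := by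
        ext l; simp [and_comm]
      rw [hfilter, add_assoc, Finset.add_sum_erase _ _ (by simp [hne.symm]),
        Finset.add_sum_erase _ _ (Finset.mem_univ i)]
    have hsum := hsplit fun l => (k l : ℝ)
    rw [← hn] at hsum
    rw [← hn, SOGeometry.blockWeight_of_ne x y hne, hsplit, hi, hj,
      Finset.sum_congr rfl fun l hm => hl l (Finset.mem_filter.1 hm).2, Finset.sum_add_distrib,
      ← Finset.mul_sum, ← Finset.mul_sum, eq_sub_of_add_eq' hsum.symm]
    generalize ∑ l with l ≠ i ∧ l ≠ j, (k l : ℝ) / (4 * (n - 2)) *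
          (y i j / (y i l * y j l) - y i l / (y i j * y j l) - y j l / (y i j * y i l)) = S
    field_simp
    ring
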